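/- For a permutation $\pi=\pi_1\pi_2\cdots\pi_n$ of $[n]=\{1,\dots,n\}$ put $\pi_0=0$. An index $1\le i\le n-1$ is an exterior peak of $\pi$ if $\pi_{i-1}<\pi_i>\pi_{i+1}$; it is of pattern $132$ if moreover $\pi_{i-1}<\pi_{i+1}$, and of pattern $231$ if moreover $\pi_{i-1}>\pi_{i+1}$. Let $T(n,i,j)$ be the number of permutations of $[n]$ with $i$ exterior peaks of pattern $132$ and $j$ exterior peaks of pattern $231$, let $T_n(x,y)=\sum_{i,j\ge 0}T(n,i,j)x^iy^j$, and put $\bar T_n(x)=T_n(x,1)$ and $\tilde T_n(y)=T_n(1,y)$. Let $T_1(n,k)$ and $T_2(n,k)$ be the numbers of permutations of $[n]$ with exactly $k$ exterior peaks of pattern $132$, respectively of pattern $231$. Then, for all $n\ge 0$, $$\bar T_n(x)=\sum_{k\ge 0}T_1(n,k)x^k,\qquad \tilde T_n(y)=\sum_{k\ge 0}T_2(n,k)y^k,$$ and the number of exterior peaks of pattern $231$ of any permutation $\pi$ of $[n]$ equals the number of its consecutive occurrences of the pattern $231$, that is, of indices $1\le i\le n-2$ with $\pi_{i+2}<\pi_i<\pi_{i+1}$.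 Moreover, as formal power series in $t$ (for $x,y$ indeterminates over $\mathbb{Q}$, or arbitrary elements of a commutative $\mathbb{Q}$-algebra, with $\int_0^t$ the term-by-term integral), $$\sum_{n=0}^{\infty}\bar T_n(x)\frac{t^n}{n!}=\frac{e^{\frac{x-1}{2}t^2}}{1-\int_0^t e^{\frac{x-1}{2}s^2}\,ds} \qquad\text{and}\qquad \sum_{n=0}^{\infty}\tilde T_n(y)\frac{t^n}{n!}=\frac{1}{1-\int_0^t e^{\frac{y-1}{2}s^2}\,ds},$$ where both denominators are invertible formal power series. -/

import Mathlib

/-- The one-line notation `π₁ π₂ ⋯ πₙ` of a permutation `π` of `[n] = {1, …, n}`, with `π₀ = 0`.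
Permutations of `[n]` are modelled on `Fin n`, so `πᵢ = π (i - 1) + 1` for `1 ≤ i ≤ n`.
The value `0` for `i > n` is never used below. -/
def permWord {n : ℕ} (π : Equiv.Perm (Fin n)) (i : ℕ) : ℕ :=
  if h : 1 ≤ i ∧ i ≤ n then (π ⟨i - 1, by omega⟩ : ℕ) + 1 else 0

/-- `πᵢ₋₁ < πᵢ > πᵢ₊₁`; used for `1 ≤ i ≤ n - 1`. -/
def IsExteriorPeak {n : ℕ} (π : Equiv.Perm (Fin n)) (i : ℕ) : Prop :=
  permWord π (i - 1) < permWord π i ∧ permWord π (i + 1) < permWord π i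

instance {n : ℕ} (π : Equiv.Perm (Fin n)) (i : ℕ) : Decidable (IsExteriorPeak π i) := by
  unfold IsExteriorPeak; infer_instance

/-- Number of exterior peaks of pattern 132: `1 ≤ i ≤ n - 1` with `πᵢ₋₁ < πᵢ₊₁ < πᵢ`. -/
def ep132 {n : ℕ} (π : Equiv.Perm (Fin n)) : ℕ :=
  ((Finset.Ico 1 n).filter fun i =>
    IsExteriorPeak π i ∧ permWord π (i - 1) < permWord π (i + 1)).card

/-- Number of exterior peaks of pattern 231: `1 ≤ i ≤ n - 1` with `πᵢ₊₁ < πᵢ₋₁ < πᵢ`. -/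
def ep231 {n : ℕ} (π : Equiv.Perm (Fin n)) : ℕ :=
  ((Finset.Ico 1 n).filter fun i =>
    IsExteriorPeak π i ∧ permWord π (i + 1) < permWord π (i - 1)).card

/-- Number of occurrences of the consecutive pattern 231: indices `1 ≤ i ≤ n - 2` with
`πᵢ₊₂ < πᵢ < πᵢ₊₁`. -/
def consecutive231 {n : ℕ} (π : Equiv.Perm (Fin n)) : ℕ :=
  ((Finset.Ico 1 (n - 1)).filter fun i =>
    permWord π (i + 2) < permWord π i ∧ permWord π i < permWord π (i + 1)).card

/-- `T(n,i,j)`: permutations of `[n]` with `i` exterior peaks of pattern 132 and `j` of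
pattern 231. -/
def countBoth (n i j : ℕ) : ℕ :=
  ((Finset.univ : Finset (Equiv.Perm (Fin n))).filter fun π => ep132 π = i ∧ ep231 π = j).card

/-- `T₁(n,k)`: permutations of `[n]` with `k` exterior peaks of pattern 132. -/
def count132 (n k : ℕ) : ℕ :=
  ((Finset.univ : Finset (Equiv.Perm (Fin n))).filter fun π => ep132 π = k).card

/-- `T₂(n,k)`: permutations of `[n]` with `k` exterior peaks of pattern 231. -/
def count231 (n k : ℕ) : ℕ :=
  ((Finset.univ : Finset (Equiv.Perm (Fin n))).filter fun π => ep231 π = k).card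

/-- `Tₙ(x,y) = ∑_{i,j ≥ 0} T(n,i,j) xⁱ yʲ`. Both statistics are at most `n`, so the summation over
`i, j ≤ n` contains all nonzero terms. -/
def jointPoly {R : Type*} [CommSemiring R] (n : ℕ) (x y : R) : R :=
  ∑ i ∈ Finset.range (n + 1), ∑ j ∈ Finset.range (n + 1), (countBoth n i j : R) * x ^ i * y ^ j

/-- The exponential generating function `∑ₙ aₙ tⁿ / n!`, a formal power series in `t`. -/
noncomputable def egf {R : Type*} [CommRing R] [Algebra ℚ R] (a : ℕ → R) : PowerSeries R :=
  PowerSeries.mk fun n => (1 / (n.factorial : ℚ)) • a n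

/-- The formal power series `e^{c t²}` in `t`. -/
noncomputable def expSq {R : Type*} [CommRing R] [Algebra ℚ R] (c : R) : PowerSeries R :=
  (PowerSeries.exp R).subst (PowerSeries.C c * PowerSeries.X ^ 2 : PowerSeries R)

/-- The formal integral `∫₀ᵗ f(s) ds`, i.e. `∑ₙ fₙ tⁿ⁺¹ / (n+1)` for `f = ∑ₙ fₙ tⁿ`. -/
noncomputable def formalIntegral {R : Type*} [CommRing R] [Algebra ℚ R] (f : PowerSeries R) :
    PowerSeries R :=
  PowerSeries.mk fun n => if n = 0 then 0 else (1 / (n : ℚ)) • PowerSeries.coeff (n - 1) f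

open Finset PowerSeries

/-! Both statistics count consecutive 132s in a word. With a 0 prepended for π₀, exterior peaks of
pattern 132 are the consecutive 132s of 0π. An exterior peak of pattern 231 cannot sit at index 1,
so these are consecutive 231s of π, and reversal turns them into consecutive 132s.

Cut a word at its least letter m, as l₁ m l₂. No occurrence straddles m, except that 0 b m is one
when l₁ = b is a single letter (`consec132_cons_append_cons`). Summing over the set of letters of l₁
gives F' = F² + (x - 1)tF with the 0 and G' = GF without it, where F(0) = G(0) = 1. With E = exp((x
- 1)t²/2), these are solved by F = E/(1 - ∫E) and G = 1/(1 - ∫E). The recurrence fixes all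
coefficients, so induction on the set of letters matches the weights with those of any solution. -/

/-- The number of consecutive occurrences of the pattern `132` in a word. -/
def consec132 : List ℕ → ℕ
  | a :: b :: c :: l => (if a < c ∧ c < b then 1 else 0) + consec132 (b :: c :: l)
  | _ => 0

/-- The least letter of an occurrence comes first, so a window in which m follows a letter of `l₁`
is never one. -/
theorem consec132_append_cons (l₁ l₂ : List ℕ) (m : ℕ) (h : ∀ a ∈ l₁, m ≤ a) :
    consec132 (l₁ ++ m :: l₂) = consec132 l₁ + consec132 (m :: l₂) := by
  induction l₁ with
  | nil => simp [consec132]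
  | cons a l ih =>
    have ih := ih fun b hb => h b (List.mem_cons_of_mem _ hb)
    have ha : ¬ a < m := not_lt.2 (h a List.mem_cons_self)
    match l, ih with
    | [], _ =>
      cases l₂ with
      | nil => simp [consec132]
      | cons c l₂ =>
        have : ¬ (a < c ∧ c < m) := by omega
        simp [consec132, this]
    | [b], ih =>
      simp only [List.cons_append, List.nil_append, consec132] at ih ⊢
      simp [ih, ha]
    | b :: c :: l, ih =>
      simp only [List.cons_append, consec132] at ih ⊢
      rw [ih, add_assoc]

/-- The first letter enters only through its comparison with the third. -/
theorem consec132_cons_eq (l : List ℕ) (m m' : ℕ) (h : ∀ a ∈ l, m < a) (h' : ∀ a ∈ l, m' < a) :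
    consec132 (m :: l) = consec132 (m' :: l) := by
  match l with
  | [] => rfl
  | [_] => rfl
  | a :: b :: l => simp [consec132, h b (by simp), h' b (by simp)]

theorem consec132_cons_append_cons (l₁ l₂ : List ℕ) (z m : ℕ) (hz : z < m)
    (h₁ : ∀ a ∈ l₁, m < a) (h₂ : ∀ a ∈ l₂, m < a) :
    consec132 (z :: (l₁ ++ m :: l₂)) =
      consec132 (z :: l₁) + consec132 (z :: l₂) + if l₁.length = 1 then 1 else 0 := by
  rw [consec132_cons_eq l₂ z m (fun a ha => hz.trans (h₂ a ha)) h₂]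
  match l₁, h₁ with
  | [], _ =>
    match l₂, h₂ with
    | [], _ => simp [consec132]
    | a :: l₂, h =>
      have : ¬ a < m := (h a (by simp)).not_gt
      simp [consec132, this]
  | [b], h =>
    have := consec132_append_cons [b] l₂ m (fun a ha => (h a ha).le)
    simp only [List.cons_append, List.nil_append, consec132] at this ⊢
    simp [this, hz, h b, add_comm]
  | b :: c :: l, h =>
    have := consec132_append_cons (b :: c :: l) l₂ m (fun a ha => (h a ha).le)
    simp only [List.cons_append, consec132] at this ⊢
    simp [this, add_assoc]

/-! ### Arrangements of a finite set, cut at a letter -/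

/-- The arrangements of the elements of a finite set in a word. -/
noncomputable def arrangements (S : Finset ℕ) : Finset (List ℕ) := S.toList.permutations.toFinset

theorem mem_arrangements {S : Finset ℕ} {l : List ℕ} :
    l ∈ arrangements S ↔ l.Nodup ∧ l.toFinset = S := by
  rw [arrangements, List.mem_toFinset, List.mem_permutations]
  constructor
  · intro h
    refine ⟨h.nodup_iff.2 S.nodup_toList, ?_⟩
    rw [List.toFinset_eq_of_perm _ _ h, toList_toFinset]
  · rintro ⟨hl, rfl⟩
    exact ((List.toFinset_toList hl).symm)

theorem length_of_mem_arrangements {S : Finset ℕ} {l : List ℕ} (h : l ∈ arrangements S) :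
    l.length = #S := by
  obtain ⟨hl, rfl⟩ := mem_arrangements.1 h
  exact (List.toFinset_card_of_nodup hl).symm

theorem mem_of_mem_arrangements {S : Finset ℕ} {l : List ℕ} (h : l ∈ arrangements S) {a : ℕ}
    (ha : a ∈ l) : a ∈ S := by
  rw [← (mem_arrangements.1 h).2]; simpa using ha

theorem arrangements_empty : arrangements ∅ = {[]} := by
  ext l
  simp only [mem_arrangements, List.toFinset_eq_empty_iff, mem_singleton]
  constructor
  · exact fun h => h.2
  · rintro rfl; simp

theorem sum_arrangements {M : Type*} [AddCommMonoid M] (S : Finset ℕ) {m : ℕ} (hm : m ∈ S)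
    (g : List ℕ → M) :
    ∑ l ∈ arrangements S, g l =
      ∑ A ∈ (S.erase m).powerset, ∑ p ∈ arrangements A ×ˢ arrangements (S.erase m \ A),
        g (p.1 ++ m :: p.2) := by
  rw [Finset.sum_sigma']
  symm
  refine Finset.sum_bij (fun p _ => p.2.1 ++ m :: p.2.2) ?_ ?_ ?_ (fun _ _ => rfl)
  · rintro ⟨A, l₁, l₂⟩ h
    simp only [mem_sigma, mem_powerset, mem_product, mem_arrangements] at h
    obtain ⟨hA, ⟨h₁, rfl⟩, h₂, e⟩ := h
    simp only [Finset.ext_iff, subset_iff, List.mem_toFinset, mem_sdiff, mem_erase] at hA e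
    rw [mem_arrangements, List.nodup_append, List.nodup_cons]
    refine ⟨⟨h₁, ⟨fun h => ?_, h₂⟩, fun a ha b hb hab => ?_⟩, ?_⟩
    · exact ((e m).1 h).1.1 rfl
    · subst hab
      rcases List.mem_cons.1 hb with rfl | hb
      · exact (hA ha).1 rfl
      · exact ((e a).1 hb).2 ha
    · ext a
      simp only [List.mem_toFinset, List.mem_append, List.mem_cons, e]
      by_cases h : a = m
      · simp [h, hm]
      · have := @hA a
        tauto
  · rintro ⟨A, l₁, l₂⟩ h ⟨A', l₁', l₂'⟩ h' e
    simp only [mem_sigma, mem_powerset, mem_product, mem_arrangements] at h h'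
    obtain ⟨hA, ⟨-, rfl⟩, -, -⟩ := h
    obtain ⟨hA', ⟨-, rfl⟩, -, -⟩ := h'
    -- Injectivity: the prefix is recovered as everything before m.
    have key : ∀ l l' : List ℕ, l.toFinset ⊆ S.erase m →
        (l ++ m :: l').takeWhile (· ≠ m) = l := by
      intro l l' h
      rw [List.takeWhile_append_of_pos]
      · simp
      · intro a ha
        have := h (List.mem_toFinset.2 ha)
        simpa using (mem_erase.1 this).1
    have e₁ : l₁ = l₁' := by
      rw [← key l₁ l₂ hA, ← key l₁' l₂' hA', e]
    subst e₁
    simp at e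
    simp [e]
  · intro l hl
    obtain ⟨hn, rfl⟩ := mem_arrangements.1 hl
    obtain ⟨l₁, l₂, rfl, h₁⟩ := List.eq_append_cons_of_mem (List.mem_toFinset.1 hm)
    rw [List.nodup_append, List.nodup_cons] at hn
    obtain ⟨n₁, ⟨h₂, n₂⟩, d⟩ := hn
    refine ⟨⟨l₁.toFinset, l₁, l₂⟩, ?_, rfl⟩
    simp only [mem_sigma, mem_powerset, mem_product, mem_arrangements]
    refine ⟨?_, ⟨n₁, trivial⟩, n₂, ?_⟩
    · intro a ha
      have ha := List.mem_toFinset.1 ha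
      simp only [mem_erase, List.mem_toFinset, List.mem_append, ha, true_or, and_true]
      rintro rfl
      exact h₁ ha
    · ext a
      simp only [List.mem_toFinset, mem_sdiff, mem_erase, List.mem_append, List.mem_cons]
      constructor
      · intro ha
        refine ⟨⟨?_, by simp [ha]⟩, fun h => d a h a (by simp [ha]) rfl⟩
        rintro rfl; exact h₂ ha
      · tauto

/-! ### Formal calculus of the closed forms -/

theorem constantCoeff_formalIntegral {R : Type*} [CommRing R] [Algebra ℚ R] (f : PowerSeries R) :
    constantCoeff (formalIntegral f) = 0 := by
  rw [← coeff_zero_eq_constantCoeff_apply, formalIntegral, coeff_mk]; simp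

theorem derivative_formalIntegral {R : Type*} [CommRing R] [Algebra ℚ R] (f : PowerSeries R) :
    derivative R (formalIntegral f) = f := by
  ext n
  rw [coeff_derivative, formalIntegral, coeff_mk, if_neg n.succ_ne_zero, Nat.add_sub_cancel,
    mul_comm, ← Nat.cast_succ, ← nsmul_eq_mul, ← Nat.cast_smul_eq_nsmul ℚ, smul_smul,
    mul_one_div_cancel (by positivity), one_smul]

theorem hasSubst_C_mul_X_sq {R : Type*} [CommRing R] (c : R) :
    HasSubst (C c * X ^ 2 : PowerSeries R) :=
  HasSubst.of_constantCoeff_zero' (by simp)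

theorem constantCoeff_expSq {R : Type*} [CommRing R] [Algebra ℚ R] (c : R) :
    constantCoeff (expSq c) = 1 := by
  have h := constantCoeff_subst (hasSubst_C_mul_X_sq c) (exp R)
  rw [finsum_eq_single _ 0 fun d hd => ?_] at h
  · refine h.trans ?_
    simp
  · refine smul_eq_zero_of_right _ ?_
    change constantCoeff ((C c * X ^ 2 : PowerSeries R) ^ d) = 0
    simp [hd]

theorem derivative_expSq {R : Type*} [CommRing R] [Algebra ℚ R] (c : R) :
    derivative R (expSq c) = C (2 * c) * X * expSq c := by
  rw [expSq, derivative_subst (hasSubst_C_mul_X_sq c), derivative_exp]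
  have h2 : C (2 : R) = 2 := map_ofNat C 2
  simp only [Derivation.leibniz, derivative_pow, derivative_X, derivative_C, map_mul, h2,
    smul_eq_mul]
  push_cast
  ring

theorem isUnit_one_sub_formalIntegral {R : Type*} [CommRing R] [Algebra ℚ R] (f : PowerSeries R) :
    IsUnit (1 - formalIntegral f) := by
  rw [PowerSeries.isUnit_iff_constantCoeff]
  simp [constantCoeff_formalIntegral]

/-- If `G = 1 / (1 - ∫ f)`, then `G' = G² f`. -/
theorem derivative_inverse_one_sub_formalIntegral {R : Type*} [CommRing R] [Algebra ℚ R]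
    (f : PowerSeries R) :
    derivative R (Ring.inverse (1 - formalIntegral f)) =
      Ring.inverse (1 - formalIntegral f) ^ 2 * f := by
  obtain ⟨u, hu⟩ := isUnit_one_sub_formalIntegral f
  rw [← hu, Ring.inverse_unit, derivative_inv, hu, map_sub, derivative_formalIntegral]
  simp

theorem constantCoeff_inverse_one_sub_formalIntegral {R : Type*} [CommRing R] [Algebra ℚ R]
    (f : PowerSeries R) :
    constantCoeff (Ring.inverse (1 - formalIntegral f)) = 1 := by
  have := congrArg constantCoeff (Ring.mul_inverse_cancel _ (isUnit_one_sub_formalIntegral f))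
  simpa [constantCoeff_formalIntegral] using this

theorem derivative_expSq_mul_inverse {R : Type*} [CommRing R] [Algebra ℚ R] (c : R) :
    derivative R (expSq c * Ring.inverse (1 - formalIntegral (expSq c))) =
      (expSq c * Ring.inverse (1 - formalIntegral (expSq c))) ^ 2 +
        C (2 * c) * X * (expSq c * Ring.inverse (1 - formalIntegral (expSq c))) := by
  rw [Derivation.leibniz, derivative_expSq, derivative_inverse_one_sub_formalIntegral]
  simp only [smul_eq_mul]
  ring

/-! ### From recurrences to differential equations -/

/-- Binomial convolution, the form taken by a sum over subsets that depends only on cardinality. -/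
theorem coeff_mul_of_scaled_coeff {R : Type*} [CommRing R] (n : ℕ) (f g : PowerSeries R) :
    ∑ k ∈ range (n + 1), n.choose k •
      (((k.factorial : R) * coeff k f) * (((n - k).factorial : R) * coeff (n - k) g)) =
    (n.factorial : R) * coeff n (f * g) := by
  rw [coeff_mul, Nat.sum_antidiagonal_eq_sum_range_succ (fun i j => coeff i f * coeff j g),
    mul_sum]
  refine sum_congr rfl fun k hk => ?_
  have hk : k ≤ n := by simpa [Nat.lt_succ_iff] using hk
  rw [← Nat.choose_mul_factorial_mul_factorial hk]
  push_cast
  rw [nsmul_eq_mul]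
  ring

theorem sum_arrangements_pow_consec132_cons {R : Type*} [CommSemiring R] (x : R) {S : Finset ℕ}
    {m : ℕ} (hm : m ∈ S) (hmin : ∀ a ∈ S, m ≤ a) (hpos : 0 < m) :
    ∑ l ∈ arrangements S, x ^ consec132 (0 :: l) =
      ∑ A ∈ (S.erase m).powerset, (∑ l ∈ arrangements A, x ^ consec132 (0 :: l)) *
        (∑ l ∈ arrangements (S.erase m \ A), x ^ consec132 (0 :: l)) *
          if #A = 1 then x else 1 := by
  rw [sum_arrangements S hm]
  refine sum_congr rfl fun A hA => ?_
  rw [sum_mul_sum, ← sum_product', sum_mul]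
  refine sum_congr rfl fun p hp => ?_
  obtain ⟨h₁, h₂⟩ := mem_product.1 hp
  have key : ∀ a ∈ S.erase m, m < a := fun a ha =>
    lt_of_le_of_ne (hmin a (mem_of_mem_erase ha)) (ne_of_mem_erase ha).symm
  rw [consec132_cons_append_cons _ _ _ _ hpos
    (fun a ha => key a (mem_powerset.1 hA (mem_of_mem_arrangements h₁ ha)))
    (fun a ha => key a (mem_sdiff.1 (mem_of_mem_arrangements h₂ ha)).1),
    length_of_mem_arrangements h₁, pow_add, pow_add]
  split_ifs <;> simp

theorem sum_arrangements_pow_consec132 {R : Type*} [CommSemiring R] (x : R) {S : Finset ℕ}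
    {m : ℕ} (hm : m ∈ S) (hmin : ∀ a ∈ S, m ≤ a) (hpos : 0 < m) :
    ∑ l ∈ arrangements S, x ^ consec132 l =
      ∑ A ∈ (S.erase m).powerset, (∑ l ∈ arrangements A, x ^ consec132 l) *
        (∑ l ∈ arrangements (S.erase m \ A), x ^ consec132 (0 :: l)) := by
  rw [sum_arrangements S hm]
  refine sum_congr rfl fun A hA => ?_
  rw [sum_mul_sum, ← sum_product']
  refine sum_congr rfl fun p hp => ?_
  obtain ⟨h₁, h₂⟩ := mem_product.1 hp
  have key : ∀ a ∈ S.erase m, m < a := fun a ha =>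
    lt_of_le_of_ne (hmin a (mem_of_mem_erase ha)) (ne_of_mem_erase ha).symm
  have h₂' := fun a ha => key a (mem_sdiff.1 (mem_of_mem_arrangements h₂ ha)).1
  rw [consec132_append_cons _ _ _
    (fun a ha => (key a (mem_powerset.1 hA (mem_of_mem_arrangements h₁ ha))).le),
    consec132_cons_eq _ m 0 h₂' (fun a ha => hpos.trans (h₂' a ha)), pow_add]

theorem factorial_succ_mul_coeff_succ {R : Type*} [CommRing R] (n : ℕ) (F : PowerSeries R) :
    ((n + 1).factorial : R) * coeff (n + 1) F = n.factorial * coeff n (derivative R F) := by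
  rw [coeff_derivative, Nat.factorial_succ]
  push_cast
  ring

/-- The weights of the arrangements of a set of positive numbers are the coefficients of a
solution of `F' = F² + d t F`, `F(0) = 1`. -/
theorem sum_arrangements_pow_consec132_cons_eq_coeff {R : Type*} [CommRing R] (x : R)
    {F : PowerSeries R} (hF : constantCoeff F = 1)
    (hF' : derivative R F = F ^ 2 + C (x - 1) * X * F) (S : Finset ℕ) (hS : ∀ a ∈ S, 0 < a) :
    ∑ l ∈ arrangements S, x ^ consec132 (0 :: l) = (#S).factorial * coeff #S F := by
  induction S using Finset.strongInduction with
  | H S ih =>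
    rcases S.eq_empty_or_nonempty with rfl | hne
    · simp [arrangements_empty, consec132, hF]
    have hm := S.min'_mem hne
    obtain ⟨m, hmm⟩ : ∃ m, m = S.min' hne := ⟨_, rfl⟩
    rw [← hmm] at hm
    have hmin : ∀ a ∈ S, m ≤ a := fun a ha => hmm ▸ S.min'_le a ha
    rw [sum_arrangements_pow_consec132_cons x hm hmin (hS m hm)]
    obtain ⟨n, hn⟩ : ∃ n, n = #(S.erase m) := ⟨_, rfl⟩
    have hcard : #S = n + 1 := by rw [hn, card_erase_add_one hm]
    have hss := erase_ssubset hm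
    -- The factor x at k = 1 is split as 1 + (x - 1): the first part yields F², the second (x -
    -- 1)tF.
    obtain ⟨f, hf⟩ : ∃ f : ℕ → R, f = fun k =>
        ((k.factorial : R) * coeff k F) * (((n - k).factorial : R) * coeff (n - k) F) +
          if k = 1 then (x - 1) * (((k.factorial : R) * coeff k F) *
            (((n - k).factorial : R) * coeff (n - k) F)) else 0 := ⟨_, rfl⟩
    have e : ∀ A ∈ (S.erase m).powerset,
        (∑ l ∈ arrangements A, x ^ consec132 (0 :: l)) *
        (∑ l ∈ arrangements (S.erase m \ A), x ^ consec132 (0 :: l)) *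
          (if #A = 1 then x else 1) =
        f #A := by
      intro A hA
      have hA := mem_powerset.1 hA
      rw [ih A (hA.trans_ssubset hss) fun a ha => hS a (hss.1 (hA ha)),
        ih (S.erase m \ A) (sdiff_subset.trans_ssubset hss)
          fun a ha => hS a (hss.1 (sdiff_subset ha)),
        card_sdiff_of_subset hA, ← hn, hf]
      dsimp only
      split_ifs <;> ring
    rw [sum_congr rfl e, sum_powerset_apply_card, ← hn, hcard, factorial_succ_mul_coeff_succ, hf, hF']
    simp only [smul_add, sum_add_distrib]
    rw [coeff_mul_of_scaled_coeff, ← sq, map_add, mul_add]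
    congr 1
    -- The weight of a one-letter set, to be matched with the coefficient 1 of t in (x - 1)tF.
    have hF₁ : coeff 1 F = 1 := by
      have := factorial_succ_mul_coeff_succ 0 F
      rw [hF'] at this
      simpa [hF] using this
    rw [mul_assoc, coeff_C_mul]
    cases n with
    | zero => simp
    | succ n =>
      rw [sum_eq_single 1 (fun k _ hk => by simp [hk]) (by simp), coeff_succ_X_mul]
      simp [hF₁, Nat.factorial_succ]
      ring

/-- Without the prepended `0`, the weights are the coefficients of the solution of `G' = G F`,
`G(0) = 1`. -/
theorem sum_arrangements_pow_consec132_eq_coeff {R : Type*} [CommRing R] (x : R)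
    {F G : PowerSeries R} (hF : constantCoeff F = 1)
    (hF' : derivative R F = F ^ 2 + C (x - 1) * X * F)
    (hG : constantCoeff G = 1) (hG' : derivative R G = G * F)
    (S : Finset ℕ) (hS : ∀ a ∈ S, 0 < a) :
    ∑ l ∈ arrangements S, x ^ consec132 l = (#S).factorial * coeff #S G := by
  induction S using Finset.strongInduction with
  | H S ih =>
    rcases S.eq_empty_or_nonempty with rfl | hne
    · simp [arrangements_empty, consec132, hG]
    have hm := S.min'_mem hne
    obtain ⟨m, hmm⟩ : ∃ m, m = S.min' hne := ⟨_, rfl⟩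
    rw [← hmm] at hm
    have hmin : ∀ a ∈ S, m ≤ a := fun a ha => hmm ▸ S.min'_le a ha
    rw [sum_arrangements_pow_consec132 x hm hmin (hS m hm)]
    obtain ⟨n, hn⟩ : ∃ n, n = #(S.erase m) := ⟨_, rfl⟩
    have hcard : #S = n + 1 := by rw [hn, card_erase_add_one hm]
    have hss := erase_ssubset hm
    obtain ⟨f, hf⟩ : ∃ f : ℕ → R, f = fun k =>
        ((k.factorial : R) * coeff k G) * (((n - k).factorial : R) * coeff (n - k) F) := ⟨_, rfl⟩
    have e : ∀ A ∈ (S.erase m).powerset,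
        (∑ l ∈ arrangements A, x ^ consec132 l) *
        (∑ l ∈ arrangements (S.erase m \ A), x ^ consec132 (0 :: l)) =
        f #A := by
      intro A hA
      have hA := mem_powerset.1 hA
      rw [ih A (hA.trans_ssubset hss) fun a ha => hS a (hss.1 (hA ha)),
        sum_arrangements_pow_consec132_cons_eq_coeff x hF hF' (S.erase m \ A)
          fun a ha => hS a (hss.1 (sdiff_subset ha)),
        card_sdiff_of_subset hA, ← hn, hf]
    rw [sum_congr rfl e, sum_powerset_apply_card, ← hn, hcard, factorial_succ_mul_coeff_succ, hf, hG',
      coeff_mul_of_scaled_coeff]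

/-! ### Translating permutations into words -/

/-- Since i + 2 stays below the length, the default of `getD` is never read. -/
theorem consec132_eq_card (l : List ℕ) :
    consec132 l = #((range (l.length - 2)).filter fun i =>
      l.getD i 0 < l.getD (i + 2) 0 ∧ l.getD (i + 2) 0 < l.getD (i + 1) 0) := by
  induction l with
  | nil => simp [consec132]
  | cons a l ih =>
    match l, ih with
    | [], _ => simp [consec132]
    | [b], _ => simp [consec132]
    | b :: c :: l, ih =>
      rw [consec132, ih]
      simp only [card_filter, List.length_cons]
      rw [show l.length + 1 + 1 + 1 - 2 = (l.length + 1 + 1 - 2) + 1 by omega, sum_range_succ',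
        add_comm]
      simp

/-- The word `π₁ ⋯ πₙ` as a list. -/
def permList {n : ℕ} (π : Equiv.Perm (Fin n)) : List ℕ := List.ofFn fun i => (π i : ℕ) + 1

theorem length_permList {n : ℕ} (π : Equiv.Perm (Fin n)) : (permList π).length = n := by
  simp [permList]

theorem getD_permList {n : ℕ} (π : Equiv.Perm (Fin n)) (i : ℕ) :
    (permList π).getD i 0 = permWord π (i + 1) := by
  rw [permList, permWord, List.getD_eq_getElem?_getD, List.getElem?_ofFn]
  by_cases h : i < n <;> simp [h]

theorem getD_cons_permList {n : ℕ} (π : Equiv.Perm (Fin n)) (i : ℕ) :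
    (0 :: permList π).getD i 0 = permWord π i := by
  cases i with
  | zero => simp [permWord]
  | succ i => rw [List.getD_cons_succ, getD_permList]

theorem sum_perm_permList {M : Type*} [AddCommMonoid M] (n : ℕ) (g : List ℕ → M) :
    ∑ π : Equiv.Perm (Fin n), g (permList π) = ∑ l ∈ arrangements (Icc 1 n), g l := by
  refine Finset.sum_bij (fun π _ => permList π) ?_ ?_ ?_ (fun _ _ => rfl)
  · intro π _
    rw [mem_arrangements, permList, List.nodup_ofFn]
    refine ⟨fun i j h => ?_, ?_⟩
    · exact π.injective (Fin.ext (Nat.succ_injective h))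
    · ext a
      simp only [List.mem_toFinset, List.mem_ofFn, mem_Icc]
      constructor
      · rintro ⟨i, rfl⟩
        have := (π i).isLt
        omega
      · rintro ⟨h₁, h₂⟩
        refine ⟨π.symm ⟨a - 1, by omega⟩, ?_⟩
        simp
        omega
  · intro π _ σ _ h
    ext i
    have := congrFun (List.ofFn_injective h) i
    simpa using this
  · intro l hl
    have hlen := length_of_mem_arrangements hl
    rw [Nat.card_Icc, Nat.add_sub_cancel] at hlen
    subst hlen
    have hmem : ∀ i : Fin l.length, 1 ≤ l.get i ∧ l.get i ≤ l.length := fun i =>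
      mem_Icc.1 (mem_of_mem_arrangements hl (List.get_mem l i))
    let f : Fin l.length → Fin l.length := fun i => ⟨l.get i - 1, by have := hmem i; omega⟩
    have hf : Function.Injective f := by
      intro i j h
      have h := congrArg Fin.val h
      simp only [f] at h
      refine List.nodup_iff_injective_get.1 (mem_arrangements.1 hl).1 ?_
      have := hmem i
      have := hmem j
      omega
    refine ⟨Equiv.ofBijective f (Finite.injective_iff_bijective.1 hf), mem_univ _, ?_⟩
    rw [permList]
    conv_rhs => rw [← List.ofFn_get l]
    congr 1
    funext i
    have := hmem i
    simp only [Equiv.ofBijective_apply, f]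
    omega

theorem ep132_eq_consec132 {n : ℕ} (π : Equiv.Perm (Fin n)) :
    ep132 π = consec132 (0 :: permList π) := by
  rw [consec132_eq_card, ep132, card_filter, card_filter, sum_Ico_eq_sum_range, List.length_cons,
    length_permList, show n + 1 - 2 = n - 1 by omega]
  refine sum_congr rfl fun i _ => ?_
  simp only [getD_cons_permList, IsExteriorPeak, Nat.add_sub_cancel_left]
  rw [show 1 + i + 1 = i + 2 by omega, show 1 + i = i + 1 by omega]
  congr 1
  apply propext
  constructor <;> rintro ⟨_, _⟩ <;> omega

theorem ep231_eq_consecutive231 {n : ℕ} (π : Equiv.Perm (Fin n)) :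
    ep231 π = consecutive231 π := by
  rw [ep231, consecutive231, card_filter, card_filter, sum_Ico_eq_sum_range, sum_Ico_eq_sum_range]
  rcases Nat.lt_or_ge n 2 with hn | hn
  · rw [show n - 1 = 0 by omega]; simp
  rw [show n - 1 = n - 1 - 1 + 1 by omega, sum_range_succ']
  -- Index 1 contributes nothing, as π₂ < π₀ = 0 is impossible; the other indices shift by one.
  have h₀ : permWord π (1 + 0 - 1) = 0 := by simp [permWord]
  simp only [h₀, not_lt_zero, and_false, if_false, add_zero]
  refine sum_congr (by simp) fun i _ => ?_
  simp only [IsExteriorPeak, Nat.add_sub_cancel_left]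
  rw [show 1 + (i + 1) + 1 = 1 + i + 2 by omega, show 1 + (i + 1) = 1 + i + 1 by omega,
    show i + 1 = 1 + i by omega]
  congr 1
  apply propext
  constructor <;> intro h <;> omega

theorem permWord_rev {n : ℕ} (π : Equiv.Perm (Fin n)) {i : ℕ} (h₁ : 1 ≤ i) (h₂ : i ≤ n) :
    permWord (Fin.revPerm.trans π) i = permWord π (n + 1 - i) := by
  rw [permWord, permWord, dif_pos ⟨h₁, h₂⟩, dif_pos ⟨by omega, by omega⟩]
  simp only [Equiv.trans_apply, Fin.revPerm_apply]
  congr 3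
  ext
  simp only [Fin.val_rev]
  omega

theorem consecutive231_rev {n : ℕ} (π : Equiv.Perm (Fin n)) :
    consecutive231 (Fin.revPerm.trans π) = consec132 (permList π) := by
  rw [consec132_eq_card, consecutive231, card_filter, card_filter, sum_Ico_eq_sum_range,
    length_permList, show n - 1 - 1 = n - 2 by omega, ← sum_range_reflect]
  refine sum_congr rfl fun i hi => ?_
  have hi := mem_range.1 hi
  simp only [getD_permList]
  rw [permWord_rev π (by omega) (by omega), permWord_rev π (by omega) (by omega),
    permWord_rev π (by omega) (by omega),
    show n + 1 - (1 + (n - 2 - 1 - i) + 2) = i + 1 by omega,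
    show n + 1 - (1 + (n - 2 - 1 - i) + 1) = i + 1 + 1 by omega,
    show n + 1 - (1 + (n - 2 - 1 - i)) = i + 2 + 1 by omega]

/-! ### Generating polynomials and conclusion -/

theorem ep132_lt {n : ℕ} (π : Equiv.Perm (Fin n)) : ep132 π < n + 1 :=
  Nat.lt_succ_iff.2 <| (card_filter_le _ _).trans (by simp)

theorem ep231_lt {n : ℕ} (π : Equiv.Perm (Fin n)) : ep231 π < n + 1 :=
  Nat.lt_succ_iff.2 <| (card_filter_le _ _).trans (by simp)

theorem sum_range_card_fiber_mul {R ι : Type*} [Semiring R] [Fintype ι] (N : ℕ)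
    (s : ι → ℕ) (hs : ∀ a, s a < N) (g : ℕ → R) :
    ∑ k ∈ range N, (#{a | s a = k} : R) * g k = ∑ a, g (s a) := by
  rw [← sum_fiberwise_of_maps_to (g := s) (t := range N) fun a _ => mem_range.2 (hs a)]
  refine sum_congr rfl fun k _ => ?_
  rw [sum_congr rfl (g := fun _ => g k) fun a ha => by rw [(mem_filter.1 ha).2], sum_const,
    nsmul_eq_mul]

theorem jointPoly_eq_sum {R : Type*} [CommSemiring R] (n : ℕ) (x y : R) :
    jointPoly n x y = ∑ π : Equiv.Perm (Fin n), x ^ ep132 π * y ^ ep231 π := by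
  rw [jointPoly, ← sum_fiberwise_of_maps_to (g := fun π => (ep132 π, ep231 π))
    (t := range (n + 1) ×ˢ range (n + 1)), sum_product]
  · refine sum_congr rfl fun i _ => sum_congr rfl fun j _ => ?_
    rw [sum_congr rfl (g := fun _ => x ^ i * y ^ j), sum_const, nsmul_eq_mul, countBoth, mul_assoc]
    · simp only [Prod.mk.injEq]
    · intro π h
      obtain ⟨rfl, rfl⟩ := Prod.mk.inj (mem_filter.1 h).2
      rfl
  · intro π _
    simp [ep132_lt, ep231_lt, -Order.lt_add_one_iff]

theorem jointPoly_one_right {R : Type*} [CommSemiring R] (n : ℕ) (x : R) :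
    jointPoly n x 1 = ∑ l ∈ arrangements (Icc 1 n), x ^ consec132 (0 :: l) := by
  rw [jointPoly_eq_sum, ← sum_perm_permList n fun l => x ^ consec132 (0 :: l)]
  simp [ep132_eq_consec132]

theorem jointPoly_one_left {R : Type*} [CommSemiring R] (n : ℕ) (y : R) :
    jointPoly n 1 y = ∑ l ∈ arrangements (Icc 1 n), y ^ consec132 l := by
  rw [jointPoly_eq_sum, ← sum_perm_permList n fun l => y ^ consec132 l]
  simp only [one_pow, one_mul, ep231_eq_consecutive231, ← consecutive231_rev]
  -- Reversing words is right multiplication by `Fin.revPerm`, a bijection of the permutations.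
  refine (Fintype.sum_equiv (Equiv.mulRight Fin.revPerm) _ _ fun π => ?_).symm
  rfl

theorem egf_eq_of_factorial_mul_coeff {R : Type*} [CommRing R] [Algebra ℚ R] {a : ℕ → R}
    {F : PowerSeries R} (h : ∀ n, a n = n.factorial * coeff n F) : egf a = F := by
  ext n
  rw [egf, coeff_mk, h, ← nsmul_eq_mul, ← Nat.cast_smul_eq_nsmul ℚ, smul_smul,
    one_div_mul_cancel (by positivity), one_smul]

theorem two_mul_half_smul {R : Type*} [CommRing R] [Algebra ℚ R] (a : R) :
    2 * ((1 / 2 : ℚ) • a) = a := by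
  rw [two_mul, ← add_smul]
  norm_num

theorem mainTheorem9 {R : Type*} [CommRing R] [Algebra ℚ R] (x y : R) :
    (∀ n : ℕ, jointPoly n x 1 = ∑ k ∈ Finset.range (n + 1), (count132 n k : R) * x ^ k) ∧
    (∀ n : ℕ, jointPoly n 1 y = ∑ k ∈ Finset.range (n + 1), (count231 n k : R) * y ^ k) ∧
    (∀ (n : ℕ) (π : Equiv.Perm (Fin n)), ep231 π = consecutive231 π) ∧
    (IsUnit (1 - formalIntegral (expSq ((1 / 2 : ℚ) • (x - 1)))) ∧
      egf (fun n => jointPoly n x 1) =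
        expSq ((1 / 2 : ℚ) • (x - 1)) *
          Ring.inverse (1 - formalIntegral (expSq ((1 / 2 : ℚ) • (x - 1))))) ∧
    (IsUnit (1 - formalIntegral (expSq ((1 / 2 : ℚ) • (y - 1)))) ∧
      egf (fun n => jointPoly n 1 y) =
        Ring.inverse (1 - formalIntegral (expSq ((1 / 2 : ℚ) • (y - 1))))) := by
  have hode (x : R) := derivative_expSq_mul_inverse ((1 / 2 : ℚ) • (x - 1))
  simp only [two_mul_half_smul] at hode
  have hone (c : R) :
      constantCoeff (expSq c * Ring.inverse (1 - formalIntegral (expSq c))) = 1 := by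
    rw [map_mul, constantCoeff_expSq, constantCoeff_inverse_one_sub_formalIntegral, one_mul]
  refine ⟨fun n => ?_, fun n => ?_, fun n π => ep231_eq_consecutive231 π,
    ⟨isUnit_one_sub_formalIntegral _, egf_eq_of_factorial_mul_coeff fun n => ?_⟩,
    ⟨isUnit_one_sub_formalIntegral _, egf_eq_of_factorial_mul_coeff fun n => ?_⟩⟩
  · simp only [jointPoly_eq_sum, one_pow, mul_one, count132]
    rw [sum_range_card_fiber_mul (n + 1) _ ep132_lt]
  · simp only [jointPoly_eq_sum, one_pow, one_mul, count231]
    rw [sum_range_card_fiber_mul (n + 1) _ ep231_lt]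
  · rw [jointPoly_one_right, sum_arrangements_pow_consec132_cons_eq_coeff x (hone _) (hode x) _
      fun a ha => (mem_Icc.1 ha).1, Nat.card_Icc, Nat.add_sub_cancel]
  · rw [jointPoly_one_left, sum_arrangements_pow_consec132_eq_coeff y (hone _) (hode y)
      (constantCoeff_inverse_one_sub_formalIntegral _) ?_ _
      fun a ha => (mem_Icc.1 ha).1, Nat.card_Icc, Nat.add_sub_cancel]
    rw [derivative_inverse_one_sub_formalIntegral]
    ring
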